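/- Let $(\Omega,\mathcal F,(\mathcal F_t)_{t\ge 0},P)$ be a filtered probability space, let $W$ be a standard Brownian motion relative to $(\mathcal F_t)$ (that is, $W$ is adapted and $W_t-W_s$ is independent of $\mathcal F_s$ for $s\le t$), and let $\mu<0$, $\sigma>0$, $z>0$. Let $S=(S_t)_{t\ge 0}$ be a geometric Brownian motion with drift $\mu$ and volatility $\sigma$ started at $z$, i.e. a continuous adapted process solving the It\^o stochastic differential equation $$\mathrm{d}S_t=\mu S_t\,\mathrm{d}t+\sigma S_t\,\mathrm{d}W_t,\qquad S_0=z .$$ Then, for every $\alpha>z$, $$P\Bigl(\sup_{t>0}S_t\ge\alpha\Bigr)\le\frac{z}{\alpha}.$$ -/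

import Mathlib

open MeasureTheory ProbabilityTheory Filter Topology
open scoped NNReal ENNReal

/-- `W` is a standard one-dimensional Brownian motion relative to the filtration `F`: it is a
Brownian motion, it is adapted to `F`, and its increments after time `s` are independent
of `F s`. -/
structure IsBrownianMotionWrt {Ω : Type*} {mΩ : MeasurableSpace Ω} (P : Measure Ω)
    (F : Filtration ℝ≥0 mΩ) (W : ℝ≥0 → Ω → ℝ) : Prop where
  isBrownian : IsBrownianReal W P
  adapted : StronglyAdapted F W
  indep : ∀ s t : ℝ≥0, s ≤ t →
    Indep (MeasurableSpace.comap (fun ω ↦ W t ω - W s ω) inferInstance) (F s) P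

/-- `I` is the Itô integral `∫₀ᵗ H dW` of a process `H` with continuous paths that is adapted to a
filtration relative to which `W` is a Brownian motion: `I` is the limit in probability of the
left-endpoint sums `∑ H(t_k) (W(t_{k+1}) - W(t_k))`, along every sequence of partitions
`0 = t_0 ≤ t_1 ≤ … ≤ t_m = t` whose mesh tends to `0`. (The `n`-th partition has `m n` cells,
and its points are `p n 0, …, p n (m n)`; later values of `p n` play no role.) -/
def IsItoIntegral {Ω : Type*} {mΩ : MeasurableSpace Ω} (P : Measure Ω)
    (H W : ℝ≥0 → Ω → ℝ) (t : ℝ≥0) (I : Ω → ℝ) : Prop :=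
  ∀ (m : ℕ → ℕ) (p : ℕ → ℕ → ℝ≥0),
    (∀ n, Monotone (p n)) → (∀ n, p n 0 = 0) → (∀ n, p n (m n) = t) →
    Tendsto (fun n ↦ (Finset.range (m n)).sup fun k ↦ p n (k + 1) - p n k) atTop (𝓝 0) →
    TendstoInMeasure P
      (fun n ω ↦ ∑ k ∈ Finset.range (m n),
        H (p n k) ω * (W (p n (k + 1)) ω - W (p n k) ω))
      atTop I

/-- `S` is a geometric Brownian motion with drift `μ` and volatility `σ`, started at `z` and driven
by the `F`-Brownian motion `W`: a continuous `F`-adapted solution of the stochastic differential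
equation `dS = μ S dt + σ S dW`, `S_0 = z`. -/
structure IsGeometricBrownianMotion {Ω : Type*} {mΩ : MeasurableSpace Ω} (P : Measure Ω)
    (F : Filtration ℝ≥0 mΩ) (W S : ℝ≥0 → Ω → ℝ) (μ σ z : ℝ) : Prop where
  brownian : IsBrownianMotionWrt P F W
  adapted : StronglyAdapted F S
  cont : ∀ᵐ ω ∂P, Continuous fun t ↦ S t ω
  initial : ∀ᵐ ω ∂P, S 0 ω = z
  sde : ∀ t : ℝ≥0, ∃ I : Ω → ℝ, IsItoIntegral P (fun s ω ↦ σ * S s ω) W t I ∧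
    ∀ᵐ ω ∂P, S t ω = S 0 ω + (∫ s in (0 : ℝ)..t, μ * S s.toNNReal ω) + I ω

/-!
The Euler sums of the equation, with coefficients read off `S` itself, converge in probability to
`S`; this is all that the definition of the Itô integral provides. The multiplicative scheme
`Y (k + 1) = Y k * (1 + ξ k)` with the same noise `ξ k = μ h + σ ΔW` obeys a maximal inequality:
since `|1 + x| ≤ 1 + x + 2 * x ^ 4` and the fourth moment of `ξ k` is `O(h²)`, `|Y|` is a
supermartingale up to a factor `exp (k (μ⁺ h + O(h²)))`. On the event that `|S| ≤ N`, an `L²`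
Gronwall argument shows that the two schemes merge as `h → 0`, so that `|S|` inherits the maximal
inequality along every finite set of times. Continuity of the paths then lets `N` tend to infinity
and the finite set exhaust a dense sequence.
-/

lemma abs_one_add_le (x : ℝ) : |1 + x| ≤ 1 + x + 2 * x ^ 4 := by
  rcases le_total (-1) x with hx | hx
  · rw [abs_of_nonneg (by linarith)]
    nlinarith [sq_nonneg (x ^ 2)]
  · rw [abs_of_nonpos (by linarith)]
    nlinarith [sq_nonneg (x ^ 2 - 1), sq_nonneg (x + 1)]

section Discrete

variable {Ω : Type*} {mΩ : MeasurableSpace Ω} {P : Measure Ω}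

section Independence

variable {m : MeasurableSpace Ω} {X ξ : Ω → ℝ}

lemma indep_comap_pow (hξ : Indep (MeasurableSpace.comap ξ inferInstance) m P) (p : ℕ) :
    Indep (MeasurableSpace.comap (fun ω ↦ ξ ω ^ p) inferInstance) m P :=
  indep_of_indep_of_le_left hξ
    ((measurable_id.pow_const p).comp (comap_measurable ξ)).comap_le

lemma indepFun_of_indep_comap (hX : Measurable[m] X)
    (hξ : Indep (MeasurableSpace.comap ξ inferInstance) m P) : IndepFun X ξ P :=
  ((IndepFun_iff_Indep ξ X P).2 (indep_of_indep_of_le_right hξ hX.comap_le)).symm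

lemma integrable_mul_of_indep_comap (hX : Measurable[m] X)
    (hξ : Indep (MeasurableSpace.comap ξ inferInstance) m P)
    (hX_int : Integrable X P) (hξ_int : Integrable ξ P) :
    Integrable (fun ω ↦ X ω * ξ ω) P :=
  (indepFun_of_indep_comap hX hξ).integrable_mul hX_int hξ_int

lemma integral_mul_of_indep_comap (hX : Measurable[m] X)
    (hξ : Indep (MeasurableSpace.comap ξ inferInstance) m P)
    (hX_int : Integrable X P) (hξ_int : Integrable ξ P) :
    ∫ ω, X ω * ξ ω ∂P = (∫ ω, X ω ∂P) * ∫ ω, ξ ω ∂P :=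
  (indepFun_of_indep_comap hX hξ).integral_fun_mul_eq_mul_integral
    hX_int.aestronglyMeasurable hξ_int.aestronglyMeasurable

end Independence

/-- A sequence of random variables with finite fourth moment, the `k`-th of which is revealed at
time `k + 1` and is independent of the past `𝒢 k`: the driving noise of the discrete schemes
`eulerSum` and `eulerProd`. -/
structure IsInnovation (P : Measure Ω) (𝒢 : Filtration ℕ mΩ) (ξ : ℕ → Ω → ℝ) : Prop where
  measurable k : Measurable[𝒢 (k + 1)] (ξ k)
  indep k : Indep (MeasurableSpace.comap (ξ k) inferInstance) (𝒢 k) P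
  memLp k : MemLp (ξ k) 4 P

namespace IsInnovation

variable [IsFiniteMeasure P] {𝒢 : Filtration ℕ mΩ} {ξ : ℕ → Ω → ℝ}

lemma memLp_two (hξ : IsInnovation P 𝒢 ξ) (k : ℕ) : MemLp (ξ k) 2 P :=
  (hξ.memLp k).mono_exponent (by norm_num)

lemma integrable (hξ : IsInnovation P 𝒢 ξ) (k : ℕ) : Integrable (ξ k) P :=
  (hξ.memLp_two k).integrable one_le_two

lemma integrable_pow_four (hξ : IsInnovation P 𝒢 ξ) (k : ℕ) :
    Integrable (fun ω ↦ ξ k ω ^ 4) P := by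
  simpa only [Real.norm_eq_abs, (by decide : Even 4).pow_abs] using
    (hξ.memLp k).integrable_norm_pow' (p := 4)

variable {k : ℕ} {X a c : Ω → ℝ}

lemma memLp_two_mul (hξ : IsInnovation P 𝒢 ξ) (ha : Measurable[𝒢 k] a) (ha2 : MemLp a 2 P) :
    MemLp (fun ω ↦ a ω * ξ k ω) 2 P := by
  refine (memLp_two_iff_integrable_sq
    (ha2.aestronglyMeasurable.mul (hξ.memLp k).aestronglyMeasurable)).2 ?_
  simpa only [Pi.mul_apply, mul_pow] using integrable_mul_of_indep_comap (ha.pow_const 2)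
    (indep_comap_pow (hξ.indep k) 2) ha2.integrable_sq (hξ.memLp_two k).integrable_sq

lemma integral_add_mul_sq (hξ : IsInnovation P 𝒢 ξ) (hX : Measurable[𝒢 k] X)
    (hX2 : MemLp X 2 P) (ha : Measurable[𝒢 k] a) (ha2 : MemLp a 2 P) :
    ∫ ω, (X ω + a ω * ξ k ω) ^ 2 ∂P =
      ∫ ω, X ω ^ 2 ∂P + (∫ ω, 2 * (X ω * a ω) ∂P) * ∫ ω, ξ k ω ∂P
        + (∫ ω, a ω ^ 2 ∂P) * ∫ ω, ξ k ω ^ 2 ∂P := by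
  have hXa : Measurable[𝒢 k] fun ω ↦ 2 * (X ω * a ω) := (hX.mul ha).const_mul 2
  have hXa_int : Integrable (fun ω ↦ 2 * (X ω * a ω)) P := (hX2.integrable_mul ha2).const_mul 2
  have hcross_int := integrable_mul_of_indep_comap hXa (hξ.indep k) hXa_int (hξ.integrable k)
  have hsq_int := integrable_mul_of_indep_comap (ha.pow_const 2) (indep_comap_pow (hξ.indep k) 2)
    ha2.integrable_sq (hξ.memLp_two k).integrable_sq
  rw [← integral_mul_of_indep_comap hXa (hξ.indep k) hXa_int (hξ.integrable k),
    ← integral_mul_of_indep_comap (ha.pow_const 2) (indep_comap_pow (hξ.indep k) 2)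
      ha2.integrable_sq (hξ.memLp_two k).integrable_sq,
    ← integral_add hX2.integrable_sq hcross_int,
    ← integral_add (hX2.integrable_sq.fun_add hcross_int) hsq_int]
  congr 1 with ω
  ring

lemma integral_add_mul_sq_le (hξ : IsInnovation P 𝒢 ξ) (hX : Measurable[𝒢 k] X)
    (hX2 : MemLp X 2 P) (ha : Measurable[𝒢 k] a) (ha2 : MemLp a 2 P) {r : Ω → ℝ}
    (hr2 : MemLp r 2 P) (ha_le : ∀ ω, |a ω| ≤ |X ω| + |r ω|) {v : ℝ}
    (hmean : |∫ ω, ξ k ω ∂P| ≤ v) (hsq : ∫ ω, ξ k ω ^ 2 ∂P ≤ v) :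
    ∫ ω, (X ω + a ω * ξ k ω) ^ 2 ∂P ≤
      (1 + 5 * v) * ∫ ω, X ω ^ 2 ∂P + 3 * v * ∫ ω, r ω ^ 2 ∂P := by
  have hcross : |∫ ω, 2 * (X ω * a ω) ∂P| ≤ 3 * ∫ ω, X ω ^ 2 ∂P + ∫ ω, r ω ^ 2 ∂P := by
    rw [← integral_const_mul, ← integral_add (hX2.integrable_sq.const_mul 3) hr2.integrable_sq,
      ← Real.norm_eq_abs]
    refine norm_integral_le_of_norm_le
      ((hX2.integrable_sq.const_mul 3).add hr2.integrable_sq) (ae_of_all _ fun ω ↦ ?_)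
    rw [Real.norm_eq_abs, abs_mul, abs_mul, abs_two, ← sq_abs (X ω), ← sq_abs (r ω)]
    nlinarith [ha_le ω, abs_nonneg (X ω), sq_nonneg (|X ω| - |r ω|)]
  have hsquare : ∫ ω, a ω ^ 2 ∂P ≤ 2 * ∫ ω, X ω ^ 2 ∂P + 2 * ∫ ω, r ω ^ 2 ∂P := by
    rw [← integral_const_mul, ← integral_const_mul,
      ← integral_add (hX2.integrable_sq.const_mul 2) (hr2.integrable_sq.const_mul 2)]
    refine integral_mono ha2.integrable_sq
      ((hX2.integrable_sq.const_mul 2).add (hr2.integrable_sq.const_mul 2)) fun ω ↦ ?_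
    simp only
    rw [← sq_abs (a ω), ← sq_abs (X ω), ← sq_abs (r ω)]
    nlinarith [ha_le ω, abs_nonneg (a ω), sq_nonneg (|X ω| - |r ω|)]
  have hcross_term : (∫ ω, 2 * (X ω * a ω) ∂P) * ∫ ω, ξ k ω ∂P ≤
      (3 * ∫ ω, X ω ^ 2 ∂P + ∫ ω, r ω ^ 2 ∂P) * v :=
    (le_abs_self _).trans <| by
      rw [abs_mul]
      exact mul_le_mul hcross hmean (abs_nonneg _) ((abs_nonneg _).trans hcross)
  have hsquare_term : (∫ ω, a ω ^ 2 ∂P) * ∫ ω, ξ k ω ^ 2 ∂P ≤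
      (2 * ∫ ω, X ω ^ 2 ∂P + 2 * ∫ ω, r ω ^ 2 ∂P) * v :=
    mul_le_mul hsquare hsq (integral_nonneg fun ω ↦ sq_nonneg _)
      ((integral_nonneg fun ω ↦ sq_nonneg _).trans hsquare)
  rw [hξ.integral_add_mul_sq hX hX2 ha ha2]
  linarith

lemma integral_abs_mul_one_add_le (hξ : IsInnovation P 𝒢 ξ) (hX : Measurable[𝒢 k] X)
    (hX_int : Integrable X P) (hc : Measurable[𝒢 k] c) (hc01 : ∀ ω, c ω ∈ Set.Icc 0 1)
    {b q : ℝ} (hb : 0 ≤ b) (hmean : ∫ ω, ξ k ω ∂P ≤ b) (hfourth : ∫ ω, ξ k ω ^ 4 ∂P ≤ q) :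
    ∫ ω, |X ω * (1 + c ω * ξ k ω)| ∂P ≤ (1 + b + 2 * q) * ∫ ω, |X ω| ∂P := by
  have hX_abs : Measurable[𝒢 k] fun ω ↦ |X ω| := continuous_abs.measurable.comp hX
  have hcX : Measurable[𝒢 k] fun ω ↦ c ω * |X ω| := hc.mul hX_abs
  have hcX_nonneg ω : 0 ≤ c ω * |X ω| := mul_nonneg (hc01 ω).1 (abs_nonneg _)
  have hcX_le ω : c ω * |X ω| ≤ |X ω| := mul_le_of_le_one_left (abs_nonneg _) (hc01 ω).2
  have hcX_int : Integrable (fun ω ↦ c ω * |X ω|) P :=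
    hX_int.mono (hcX.mono (𝒢.le k) le_rfl).aestronglyMeasurable <| ae_of_all _ fun ω ↦ by
      rw [Real.norm_eq_abs, abs_of_nonneg (hcX_nonneg ω)]
      exact hcX_le ω
  have hcross_int := integrable_mul_of_indep_comap hcX (hξ.indep k) hcX_int (hξ.integrable k)
  have hfour_int := integrable_mul_of_indep_comap hX_abs (indep_comap_pow (hξ.indep k) 4)
    hX_int.abs (hξ.integrable_pow_four k)
  have hpointwise ω : |X ω * (1 + c ω * ξ k ω)| ≤
      |X ω| + c ω * |X ω| * ξ k ω + 2 * (|X ω| * ξ k ω ^ 4) := by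
    have hfour : (c ω * ξ k ω) ^ 4 ≤ ξ k ω ^ 4 := by
      rw [mul_pow]
      exact mul_le_of_le_one_left (by positivity) (pow_le_one₀ (hc01 ω).1 (hc01 ω).2)
    rw [abs_mul]
    nlinarith [abs_one_add_le (c ω * ξ k ω), abs_nonneg (X ω)]
  have hcX_mean : (∫ ω, c ω * |X ω| ∂P) * ∫ ω, ξ k ω ∂P ≤ (∫ ω, |X ω| ∂P) * b :=
    (mul_le_mul_of_nonneg_left hmean (integral_nonneg hcX_nonneg)).trans <|
      mul_le_mul_of_nonneg_right (integral_mono hcX_int hX_int.abs hcX_le) hb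
  have hX_fourth : (∫ ω, |X ω| ∂P) * ∫ ω, ξ k ω ^ 4 ∂P ≤ (∫ ω, |X ω| ∂P) * q :=
    mul_le_mul_of_nonneg_left hfourth (integral_nonneg fun ω ↦ abs_nonneg _)
  calc ∫ ω, |X ω * (1 + c ω * ξ k ω)| ∂P
      ≤ ∫ ω, (|X ω| + c ω * |X ω| * ξ k ω + 2 * (|X ω| * ξ k ω ^ 4)) ∂P :=
        integral_mono_of_nonneg (ae_of_all _ fun ω ↦ abs_nonneg _)
          ((hX_int.abs.fun_add hcross_int).fun_add (hfour_int.const_mul 2))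
          (ae_of_all _ hpointwise)
    _ = ∫ ω, |X ω| ∂P + (∫ ω, c ω * |X ω| ∂P) * ∫ ω, ξ k ω ∂P
          + 2 * ((∫ ω, |X ω| ∂P) * ∫ ω, ξ k ω ^ 4 ∂P) := by
        rw [integral_add (hX_int.abs.fun_add hcross_int) (hfour_int.const_mul 2),
          integral_add hX_int.abs hcross_int, integral_const_mul,
          integral_mul_of_indep_comap hcX (hξ.indep k) hcX_int (hξ.integrable k),
          integral_mul_of_indep_comap hX_abs (indep_comap_pow (hξ.indep k) 4) hX_int.abs
            (hξ.integrable_pow_four k)]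
    _ ≤ (1 + b + 2 * q) * ∫ ω, |X ω| ∂P := by linarith

end IsInnovation

end Discrete

section Schemes

variable {Ω : Type*} {mΩ : MeasurableSpace Ω} {P : Measure Ω}

/-- The additive scheme `X (k + 1) = X k + U k * ξ k`, `X 0 = z`, with prescribed coefficients. -/
noncomputable def eulerSum (z : ℝ) (U ξ : ℕ → Ω → ℝ) (k : ℕ) (ω : Ω) : ℝ :=
  z + ∑ i ∈ Finset.range k, U i ω * ξ i ω

/-- The multiplicative scheme `Y (k + 1) = Y k * (1 + c k * ξ k)`, `Y 0 = z`; the weights `c` switch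
the noise on and off. -/
noncomputable def eulerProd (z : ℝ) (c ξ : ℕ → Ω → ℝ) (k : ℕ) (ω : Ω) : ℝ :=
  z * ∏ i ∈ Finset.range k, (1 + c i ω * ξ i ω)

lemma eulerSum_zero (z : ℝ) (U ξ : ℕ → Ω → ℝ) : eulerSum z U ξ 0 = fun _ ↦ z := by
  funext ω
  simp [eulerSum]

lemma eulerProd_zero (z : ℝ) (c ξ : ℕ → Ω → ℝ) : eulerProd z c ξ 0 = fun _ ↦ z := by
  funext ω
  simp [eulerProd]

lemma eulerSum_succ (z : ℝ) (U ξ : ℕ → Ω → ℝ) (k : ℕ) (ω : Ω) :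
    eulerSum z U ξ (k + 1) ω = eulerSum z U ξ k ω + U k ω * ξ k ω := by
  rw [eulerSum, eulerSum, Finset.sum_range_succ, add_assoc]

lemma eulerProd_succ (z : ℝ) (c ξ : ℕ → Ω → ℝ) (k : ℕ) (ω : Ω) :
    eulerProd z c ξ (k + 1) ω = eulerProd z c ξ k ω * (1 + c k ω * ξ k ω) := by
  rw [eulerProd, eulerProd, Finset.prod_range_succ, mul_assoc]

lemma eulerSum_congr (z : ℝ) {U V : ℕ → Ω → ℝ} (ξ : ℕ → Ω → ℝ) {k : ℕ} {ω : Ω}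
    (h : ∀ i < k, U i ω = V i ω) : eulerSum z U ξ k ω = eulerSum z V ξ k ω :=
  congr_arg (z + ·) <| Finset.sum_congr rfl fun i hi ↦ by rw [h i (Finset.mem_range.1 hi)]

lemma eulerProd_eq_eulerSum (z : ℝ) (c ξ : ℕ → Ω → ℝ) (k : ℕ) (ω : Ω) :
    eulerProd z c ξ k ω = eulerSum z (fun i ω ↦ c i ω * eulerProd z c ξ i ω) ξ k ω := by
  induction k with
  | zero => rw [eulerProd_zero, eulerSum_zero]
  | succ k ih =>
    rw [eulerSum_succ, ← ih, eulerProd_succ]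
    ring

lemma eulerSum_sub_eulerProd (z : ℝ) (U c ξ : ℕ → Ω → ℝ) (k : ℕ) (ω : Ω) :
    eulerSum z U ξ k ω - eulerProd z c ξ k ω =
      eulerSum 0 (fun i ω ↦ U i ω - c i ω * eulerProd z c ξ i ω) ξ k ω := by
  rw [eulerProd_eq_eulerSum]
  simp only [eulerSum, sub_mul, Finset.sum_sub_distrib]
  ring

variable {𝒢 : Filtration ℕ mΩ} {ξ U c : ℕ → Ω → ℝ}

namespace IsInnovation

lemma adapted_eulerSum (hξ : IsInnovation P 𝒢 ξ) (z : ℝ) (hU : Adapted 𝒢 U) :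
    Adapted 𝒢 (eulerSum z U ξ) := by
  intro k
  induction k with
  | zero => exact eulerSum_zero z U ξ ▸ measurable_const
  | succ k ih =>
    simp only [funext (eulerSum_succ z U ξ k)]
    exact (ih.mono (𝒢.mono k.le_succ) le_rfl).add
      ((hU.measurable_le k.le_succ).mul (hξ.measurable k))

lemma adapted_eulerProd (hξ : IsInnovation P 𝒢 ξ) (z : ℝ) (hc : Adapted 𝒢 c) :
    Adapted 𝒢 (eulerProd z c ξ) := by
  intro k
  induction k with
  | zero => exact eulerProd_zero z c ξ ▸ measurable_const
  | succ k ih =>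
    simp only [funext (eulerProd_succ z c ξ k)]
    exact (ih.mono (𝒢.mono k.le_succ) le_rfl).mul
      (((hc.measurable_le k.le_succ).mul (hξ.measurable k)).const_add 1)

variable [IsFiniteMeasure P]

lemma memLp_two_eulerSum (hξ : IsInnovation P 𝒢 ξ) (z : ℝ) (hU : Adapted 𝒢 U)
    (hU2 : ∀ k, MemLp (U k) 2 P) (k : ℕ) : MemLp (eulerSum z U ξ k) 2 P := by
  induction k with
  | zero => exact eulerSum_zero z U ξ ▸ memLp_const z
  | succ k ih =>
    rw [funext (eulerSum_succ z U ξ k)]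
    exact ih.add (hξ.memLp_two_mul (hU k) (hU2 k))

lemma memLp_two_eulerProd (hξ : IsInnovation P 𝒢 ξ) (z : ℝ) (hc : Adapted 𝒢 c)
    (hc1 : ∀ k ω, |c k ω| ≤ 1) (k : ℕ) : MemLp (eulerProd z c ξ k) 2 P := by
  induction k with
  | zero => exact eulerProd_zero z c ξ ▸ memLp_const z
  | succ k ih =>
    have hcY : Measurable[𝒢 k] fun ω ↦ c k ω * eulerProd z c ξ k ω :=
      (hc k).mul (hξ.adapted_eulerProd z hc k)
    have hcY2 : MemLp (fun ω ↦ c k ω * eulerProd z c ξ k ω) 2 P :=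
      ih.of_le (hcY.mono (𝒢.le k) le_rfl).aestronglyMeasurable <| ae_of_all _ fun ω ↦ by
        rw [norm_mul]
        exact mul_le_of_le_one_left (norm_nonneg _) (hc1 k ω)
    refine (ih.add (hξ.memLp_two_mul hcY hcY2)).ae_eq (ae_of_all _ fun ω ↦ ?_)
    simp only [Pi.add_apply, eulerProd_succ]
    ring

lemma integral_eulerSum_sq_le (hξ : IsInnovation P 𝒢 ξ) {a r : ℕ → Ω → ℝ}
    (ha : Adapted 𝒢 a) (hr2 : ∀ k, MemLp (r k) 2 P) (ha2 : ∀ k, MemLp (a k) 2 P)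
    (ha_le : ∀ k ω, |a k ω| ≤ |eulerSum 0 a ξ k ω| + |r k ω|) {v : ℝ}
    (hmean : ∀ k, |∫ ω, ξ k ω ∂P| ≤ v) (hsq : ∀ k, ∫ ω, ξ k ω ^ 2 ∂P ≤ v) (n : ℕ) :
    ∫ ω, eulerSum 0 a ξ n ω ^ 2 ∂P ≤
      (3 * ∑ k ∈ Finset.range n, v * ∫ ω, r k ω ^ 2 ∂P) * Real.exp (5 * (n * v)) := by
  have hv : 0 ≤ v := (abs_nonneg _).trans (hmean 0)
  have hstep k : ∫ ω, eulerSum 0 a ξ (k + 1) ω ^ 2 ∂P ≤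
      (1 + 5 * v) * ∫ ω, eulerSum 0 a ξ k ω ^ 2 ∂P + 3 * v * ∫ ω, r k ω ^ 2 ∂P := by
    simp only [eulerSum_succ]
    exact hξ.integral_add_mul_sq_le (hξ.adapted_eulerSum 0 ha k)
      (hξ.memLp_two_eulerSum 0 ha ha2 k) (ha k) (ha2 k) (hr2 k) (ha_le k) (hmean k) (hsq k)
  have hgronwall := discrete_gronwall (n₀ := 0) (u := fun n ↦ ∫ ω, eulerSum 0 a ξ n ω ^ 2 ∂P)
    (c := fun _ ↦ 5 * v) (b := fun k ↦ 3 * v * ∫ ω, r k ω ^ 2 ∂P)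
    (integral_nonneg fun ω ↦ sq_nonneg _) (fun k _ ↦ hstep k) (fun _ _ ↦ by positivity)
    (fun k _ ↦ mul_nonneg (by positivity) (integral_nonneg fun ω ↦ sq_nonneg _)) n.zero_le
  refine hgronwall.trans_eq ?_
  simp [eulerSum, Finset.mul_sum, mul_assoc, mul_left_comm]

lemma setIntegral_abs_eulerProd_succ_le (hξ : IsInnovation P 𝒢 ξ) (z : ℝ) (hc : Adapted 𝒢 c)
    (hc01 : ∀ k ω, c k ω ∈ Set.Icc 0 1) {b q : ℝ} (hb : 0 ≤ b)
    (hmean : ∀ k, ∫ ω, ξ k ω ∂P ≤ b) (hfourth : ∀ k, ∫ ω, ξ k ω ^ 4 ∂P ≤ q) {k : ℕ} {s : Set Ω}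
    (hs : MeasurableSet[𝒢 k] s) :
    ∫ ω in s, |eulerProd z c ξ (k + 1) ω| ∂P ≤
      (1 + b + 2 * q) * ∫ ω in s, |eulerProd z c ξ k ω| ∂P := by
  have hc1 k ω : |c k ω| ≤ 1 := (abs_of_nonneg (hc01 k ω).1).trans_le (hc01 k ω).2
  have hY_int := (hξ.memLp_two_eulerProd z hc hc1 k).integrable one_le_two
  have hle := hξ.integral_abs_mul_one_add_le ((hξ.adapted_eulerProd z hc k).indicator hs)
    (hY_int.indicator (𝒢.le k s hs)) (hc k) (hc01 k) hb (hmean k) (hfourth k)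
  rw [← integral_indicator (𝒢.le k s hs), ← integral_indicator (𝒢.le k s hs)]
  convert hle using 3 with ω
  · by_cases hω : ω ∈ s <;> simp [hω, eulerProd_succ]
  · congr 1 with ω
    by_cases hω : ω ∈ s <;> simp [hω]

lemma supermartingale_abs_eulerProd (hξ : IsInnovation P 𝒢 ξ) (z : ℝ) (hc : Adapted 𝒢 c)
    (hc01 : ∀ k ω, c k ω ∈ Set.Icc 0 1) {b q : ℝ} (hb : 0 ≤ b) (hq : 0 ≤ q)
    (hmean : ∀ k, ∫ ω, ξ k ω ∂P ≤ b) (hfourth : ∀ k, ∫ ω, ξ k ω ^ 4 ∂P ≤ q) :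
    Supermartingale (fun k ω ↦ ((1 + b + 2 * q) ^ k)⁻¹ * |eulerProd z c ξ k ω|) 𝒢 P := by
  have hc1 k ω : |c k ω| ≤ 1 := (abs_of_nonneg (hc01 k ω).1).trans_le (hc01 k ω).2
  refine supermartingale_of_setIntegral_succ_le
    (fun k ↦ ((continuous_abs.measurable.comp (hξ.adapted_eulerProd z hc k)).const_mul
      _).stronglyMeasurable)
    (fun k ↦ ((hξ.memLp_two_eulerProd z hc hc1 k).integrable one_le_two).abs.const_mul _)
    fun k s hs ↦ ?_
  rw [integral_const_mul, integral_const_mul, pow_succ, mul_inv, mul_assoc]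
  gcongr
  rw [inv_mul_le_iff₀ (by positivity)]
  exact hξ.setIntegral_abs_eulerProd_succ_le z hc hc01 hb hmean hfourth hs

end IsInnovation

lemma mul_measureReal_exists_le_le_integral [IsFiniteMeasure P] {f : ℕ → Ω → ℝ}
    (hf : Supermartingale f 𝒢 P) (hf0 : 0 ≤ f) (ε : ℝ) (n : ℕ) :
    ε * P.real {ω | ∃ k ≤ n, ε ≤ f k ω} ≤ ∫ ω, f 0 ω ∂P := by
  let τ : Ω → ℕ∞ := fun ω ↦ (hittingBtwn f (Set.Ici ε) 0 n ω : ℕ)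
  have hτ : IsStoppingTime 𝒢 τ :=
    hf.stronglyAdapted.adapted.isStoppingTime_hittingBtwn measurableSet_Ici
  have hτ_le ω : τ ω ≤ n := Nat.cast_le.2 (hittingBtwn_le ω)
  have hint : Integrable (stoppedValue f τ) P := integrable_stoppedValue ℕ hτ hf.integrable hτ_le
  have hstopped : ∫ ω, stoppedValue f τ ω ∂P ≤ ∫ ω, f 0 ω ∂P := by
    have hneg := hf.neg.expected_stoppedValue_mono (isStoppingTime_const 𝒢 0) hτ
      (fun _ ↦ zero_le) hτ_le
    rw [stoppedValue_const] at hneg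
    simpa only [stoppedValue, Pi.neg_apply, integral_neg, neg_le_neg_iff] using hneg
  have hreached : {ω | ∃ k ≤ n, ε ≤ f k ω} ⊆ {ω | ε ≤ stoppedValue f τ ω} := by
    rintro ω ⟨k, hk, hεk⟩
    exact stoppedValue_hittingBtwn_mem ⟨k, ⟨k.zero_le, hk⟩, hεk⟩
  rcases le_total ε 0 with hε | hε
  · exact (mul_nonpos_of_nonpos_of_nonneg hε measureReal_nonneg).trans
      (integral_nonneg (hf0 0))
  calc ε * P.real {ω | ∃ k ≤ n, ε ≤ f k ω}
      ≤ ε * P.real {ω | ε ≤ stoppedValue f τ ω} := by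
        gcongr
        finiteness
    _ ≤ ∫ ω, stoppedValue f τ ω ∂P :=
        mul_meas_ge_le_integral_of_nonneg (ae_of_all _ fun ω ↦ hf0 _ ω) hint ε
    _ ≤ ∫ ω, f 0 ω ∂P := hstopped

lemma IsInnovation.measureReal_exists_le_abs_eulerProd_le [IsProbabilityMeasure P]
    (hξ : IsInnovation P 𝒢 ξ) (z : ℝ) (hc : Adapted 𝒢 c) (hc01 : ∀ k ω, c k ω ∈ Set.Icc 0 1)
    {b q : ℝ} (hb : 0 ≤ b) (hq : 0 ≤ q) (hmean : ∀ k, ∫ ω, ξ k ω ∂P ≤ b)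
    (hfourth : ∀ k, ∫ ω, ξ k ω ^ 4 ∂P ≤ q) {β : ℝ} (hβ : 0 < β) (n : ℕ) :
    P.real {ω | ∃ k ≤ n, β ≤ |eulerProd z c ξ k ω|} ≤
      |z| * Real.exp (n * (b + 2 * q)) / β := by
  set ρ : ℝ := 1 + b + 2 * q with hρ
  have hρ_one : 1 ≤ ρ := by linarith
  have hsub : {ω | ∃ k ≤ n, β ≤ |eulerProd z c ξ k ω|} ⊆
      {ω | ∃ k ≤ n, (ρ ^ n)⁻¹ * β ≤ (ρ ^ k)⁻¹ * |eulerProd z c ξ k ω|} := by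
    rintro ω ⟨k, hk, hβk⟩
    exact ⟨k, hk, mul_le_mul (inv_anti₀ (by positivity) (pow_le_pow_right₀ hρ_one hk)) hβk
      hβ.le (by positivity)⟩
  have hmax := mul_measureReal_exists_le_le_integral
    (hξ.supermartingale_abs_eulerProd z hc hc01 hb hq hmean hfourth)
    (fun k ω ↦ by positivity) ((ρ ^ n)⁻¹ * β) n
  have hρ_exp : ρ ^ n ≤ Real.exp (n * (b + 2 * q)) := by
    rw [Real.exp_nat_mul]
    gcongr
    linarith [Real.add_one_le_exp (b + 2 * q)]
  simp only [pow_zero, inv_one, one_mul, eulerProd_zero, integral_const, probReal_univ,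
    smul_eq_mul, ← hρ, mul_assoc] at hmax
  rw [inv_mul_le_iff₀ (by positivity), mul_comm β] at hmax
  rw [le_div_iff₀ hβ, mul_comm |z|]
  calc P.real {ω | ∃ k ≤ n, β ≤ |eulerProd z c ξ k ω|} * β
      ≤ P.real {ω | ∃ k ≤ n, (ρ ^ n)⁻¹ * β ≤ (ρ ^ k)⁻¹ * |eulerProd z c ξ k ω|} * β := by
        gcongr
        finiteness
    _ ≤ ρ ^ n * |z| := hmax
    _ ≤ Real.exp (n * (b + 2 * q)) * |z| := by gcongr

end Schemes

lemma integrable_pow_gaussianReal (m : ℝ) (v : ℝ≥0) (p : ℕ) :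
    Integrable (fun x ↦ x ^ p) (gaussianReal m v) :=
  ((memLp_id_gaussianReal (p : ℝ≥0)).integrable_norm_pow' (p := p)).mono
    (by fun_prop) (ae_of_all _ fun x ↦ by simp)

lemma integral_pow_four_gaussianReal_le (m : ℝ) (v : ℝ≥0) :
    ∫ x, x ^ 4 ∂(gaussianReal m v) ≤
      8 * (m ^ 4 + v ^ 2 * ∫ x, x ^ 4 ∂(gaussianReal 0 1)) := by
  have hlaw : HasLaw (fun x ↦ √(v : ℝ) * x + m) (gaussianReal m v) (gaussianReal 0 1) := by
    have hid : HasLaw (fun x : ℝ ↦ x) (gaussianReal 0 1) (gaussianReal 0 1) := HasLaw.id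
    convert gaussianReal_add_const (gaussianReal_const_mul hid √(v : ℝ)) m using 2
    · ring
    · ext; simp
  have hcomp : ∫ x, x ^ 4 ∂(gaussianReal m v) =
      ∫ x, (√(v : ℝ) * x + m) ^ 4 ∂(gaussianReal 0 1) :=
    (hlaw.integral_comp (f := fun x ↦ x ^ 4) (by fun_prop)).symm
  have hint := integrable_pow_gaussianReal 0 1 4
  have hbound_int : Integrable (fun x ↦ 8 * ((v : ℝ) ^ 2 * x ^ 4 + m ^ 4)) (gaussianReal 0 1) :=
    ((hint.const_mul _).fun_add (integrable_const _)).const_mul 8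
  have hsqrt : √(v : ℝ) ^ 4 = v ^ 2 := by
    rw [show 4 = 2 * 2 from rfl, pow_mul, Real.sq_sqrt v.coe_nonneg]
  calc ∫ x, x ^ 4 ∂(gaussianReal m v)
      = ∫ x, (√(v : ℝ) * x + m) ^ 4 ∂(gaussianReal 0 1) := hcomp
    _ ≤ ∫ x, 8 * ((v : ℝ) ^ 2 * x ^ 4 + m ^ 4) ∂(gaussianReal 0 1) := by
        refine integral_mono_of_nonneg (ae_of_all _ fun x ↦ by positivity) hbound_int
          (ae_of_all _ fun x ↦ ?_)
        refine ((by decide : Even 4).add_pow_le).trans_eq ?_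
        rw [mul_pow, hsqrt]
        norm_num
    _ = 8 * (m ^ 4 + v ^ 2 * ∫ x, x ^ 4 ∂(gaussianReal 0 1)) := by
        rw [integral_const_mul, integral_add (hint.const_mul _) (integrable_const _),
          integral_const_mul, integral_const, probReal_univ, one_smul, add_comm]

lemma integral_sq_gaussianReal (m : ℝ) (v : ℝ≥0) :
    ∫ x, x ^ 2 ∂(gaussianReal m v) = v + m ^ 2 := by
  have hvar := variance_eq_sub (memLp_id_gaussianReal (μ := m) (v := v) 2)
  simp only [variance_id_gaussianReal, Pi.pow_apply, id_eq, integral_id_gaussianReal] at hvar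
  linarith

section Grid

variable {Ω : Type*} {mΩ : MeasurableSpace Ω} {P : Measure Ω} {F : Filtration ℝ≥0 mΩ}
  {W : ℝ≥0 → Ω → ℝ}

/-- The restriction of a continuous-time filtration to the grid `0, h, 2h, …`. -/
def gridFiltration (F : Filtration ℝ≥0 mΩ) (h : ℝ≥0) : Filtration ℕ mΩ where
  seq k := F (k * h)
  mono' _ _ hij := F.mono (by gcongr)
  le' _ := F.le _

/-- The increment of `μ t + σ W t` over the `k`-th cell of the grid of step `h`. -/
def gridNoise (W : ℝ≥0 → Ω → ℝ) (μ σ : ℝ) (h : ℝ≥0) (k : ℕ) (ω : Ω) : ℝ :=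
  μ * h + σ * (W ((k + 1 : ℕ) * h) ω - W (k * h) ω)

lemma adapted_gridFiltration {X : ℝ≥0 → Ω → ℝ} (hX : StronglyAdapted F X) (h : ℝ≥0) :
    Adapted (gridFiltration F h) fun k ↦ X (k * h) :=
  fun k ↦ (hX (k * h)).measurable

namespace IsBrownianMotionWrt

lemma hasLaw_gridNoise (hW : IsBrownianMotionWrt P F W) (μ σ : ℝ) (h : ℝ≥0) (k : ℕ) :
    HasLaw (gridNoise W μ σ h k) (gaussianReal (μ * h) (.mk (σ ^ 2) (sq_nonneg _) * h)) P := by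
  have hdist : nndist ((k + 1 : ℕ) * h : ℝ≥0).1 (k * h : ℝ≥0).1 = h := by
    ext
    rw [coe_nndist, Real.dist_eq]
    change |(((k + 1 : ℕ) * h : ℝ≥0) : ℝ) - (k * h : ℝ≥0)| = h
    push_cast
    rw [show ((k : ℝ) + 1) * h - k * h = h by ring, NNReal.abs_eq]
  have hincr := hW.isBrownian.hasLaw_sub ((k + 1 : ℕ) * h) (k * h)
  rw [hdist] at hincr
  have := gaussianReal_const_add (gaussianReal_const_mul hincr σ) (μ * h)
  rwa [mul_zero, zero_add] at this

lemma isInnovation_gridNoise (hW : IsBrownianMotionWrt P F W) (μ σ : ℝ) (h : ℝ≥0) :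
    IsInnovation P (gridFiltration F h) (gridNoise W μ σ h) where
  measurable k := by
    have hW_adapted := adapted_gridFiltration hW.adapted h
    exact (((hW_adapted (k + 1)).sub (hW_adapted.measurable_le k.le_succ)).const_mul σ).const_add
      (μ * h)
  indep k := indep_of_indep_of_le_left
    (hW.indep (k * h) ((k + 1 : ℕ) * h) (by gcongr; exact k.le_succ))
    (((measurable_id.const_mul σ).const_add (μ * (h : ℝ))).comp
      (comap_measurable fun ω ↦ W ((k + 1 : ℕ) * h) ω - W (k * h) ω)).comap_le
  memLp k := by
    have hlaw := hW.hasLaw_gridNoise μ σ h k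
    have := memLp_id_gaussianReal (μ := μ * h) (v := .mk (σ ^ 2) (sq_nonneg _) * h) 4
    rw [← hlaw.map_eq, memLp_map_measure_iff aestronglyMeasurable_id hlaw.aemeasurable] at this
    exact this

lemma integral_gridNoise (hW : IsBrownianMotionWrt P F W) (μ σ : ℝ) (h : ℝ≥0) (k : ℕ) :
    ∫ ω, gridNoise W μ σ h k ω ∂P = μ * h := by
  rw [(hW.hasLaw_gridNoise μ σ h k).integral_eq, integral_id_gaussianReal]

lemma integral_gridNoise_sq_le (hW : IsBrownianMotionWrt P F W) (μ σ : ℝ) {h : ℝ≥0} (hh : h ≤ 1)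
    (k : ℕ) : ∫ ω, gridNoise W μ σ h k ω ^ 2 ∂P ≤ (μ ^ 2 + σ ^ 2) * h := by
  have hcomp := (hW.hasLaw_gridNoise μ σ h k).integral_comp (f := fun x ↦ x ^ 2) (by fun_prop)
  simp only [Function.comp_def, integral_sq_gaussianReal] at hcomp
  rw [hcomp]
  have hh_real : (h : ℝ) ≤ 1 := by exact_mod_cast hh
  simp only [NNReal.coe_mul, NNReal.coe_mk]
  nlinarith [hh_real, mul_nonneg (sq_nonneg μ) h.coe_nonneg]

lemma exists_integral_gridNoise_pow_four_le (hW : IsBrownianMotionWrt P F W) (μ σ : ℝ) :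
    ∃ C : ℝ, 0 ≤ C ∧ ∀ h : ℝ≥0, h ≤ 1 → ∀ k,
      ∫ ω, gridNoise W μ σ h k ω ^ 4 ∂P ≤ C * h * h := by
  refine ⟨8 * (μ ^ 4 + σ ^ 4 * ∫ x, x ^ 4 ∂(gaussianReal 0 1)), by positivity, fun h hh k ↦ ?_⟩
  have hcomp := (hW.hasLaw_gridNoise μ σ h k).integral_comp (f := fun x ↦ x ^ 4) (by fun_prop)
  simp only [Function.comp_def] at hcomp
  rw [hcomp]
  refine (integral_pow_four_gaussianReal_le _ _).trans ?_
  have hh' : (h : ℝ) ^ 2 ≤ 1 := pow_le_one₀ h.2 (by exact_mod_cast hh)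
  simp only [NNReal.coe_mul, NNReal.coe_mk]
  nlinarith [mul_nonneg (by positivity : 0 ≤ μ ^ 4) (sq_nonneg (h : ℝ))]

end IsBrownianMotionWrt

end Grid

section RiemannSums

lemma sum_indicator_Ico_mul_eq_ite {h s : ℝ} (hh : 0 < h) (hs : 0 ≤ s) (f : ℕ → ℝ) (M : ℕ) :
    ∑ k ∈ Finset.range M, (Set.Ico (k * h) ((k + 1) * h)).indicator (fun _ ↦ f k) s =
      if ⌊s / h⌋₊ < M then f ⌊s / h⌋₊ else 0 := by
  have hmem (k : ℕ) : s ∈ Set.Ico (k * h) ((k + 1) * h) ↔ ⌊s / h⌋₊ = k := by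
    rw [Nat.floor_eq_iff (by positivity), le_div_iff₀ hh, div_lt_iff₀ hh, Set.mem_Ico]
  simp only [Set.indicator_apply, hmem, Finset.sum_ite_eq, Finset.mem_range]

lemma integral_sum_indicator_Ico_mul {h t : ℝ} (hh : 0 ≤ h) (f : ℕ → ℝ) {M : ℕ}
    (hMt : M * h ≤ t) :
    ∫ s in (0 : ℝ)..t, ∑ k ∈ Finset.range M,
        (Set.Ico (k * h) ((k + 1) * h)).indicator (fun _ ↦ f k) s =
      ∑ k ∈ Finset.range M, h * f k := by
  have ht : 0 ≤ t := (by positivity : 0 ≤ M * h).trans hMt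
  rw [intervalIntegral.integral_of_le ht, ← integral_Icc_eq_integral_Ioc, integral_finsetSum _
    fun k _ ↦ (integrable_const _).indicator measurableSet_Ico]
  refine Finset.sum_congr rfl fun k hk ↦ ?_
  have hsub : Set.Ico (k * h) ((k + 1) * h) ⊆ Set.Icc 0 t := by
    refine Set.Ico_subset_Icc_self.trans (Set.Icc_subset_Icc (by positivity) (le_trans ?_ hMt))
    gcongr
    exact_mod_cast Finset.mem_range.1 hk
  rw [setIntegral_indicator measurableSet_Ico, Set.inter_eq_right.2 hsub, setIntegral_const,
    Real.volume_real_Ico_of_le (by nlinarith), smul_eq_mul]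
  ring

variable {h : ℕ → ℝ≥0} {t : ℝ≥0}

lemma floor_div_mul_le (t : ℝ≥0) {h : ℝ≥0} (hh : 0 < h) : ⌊t / h⌋₊ * h ≤ t :=
  (le_div_iff₀ hh).1 (Nat.floor_le zero_le)

lemma tendsto_floor_div_mul (t : ℝ≥0) (hpos : ∀ n, 0 < h n) (hh : Tendsto h atTop (𝓝 0)) :
    Tendsto (fun n ↦ ⌊t / h n⌋₊ * h n) atTop (𝓝 t) := by
  have hlower : Tendsto (fun n ↦ t - h n) atTop (𝓝 t) := by
    simpa only [tsub_zero] using (tendsto_const_nhds (x := t)).sub hh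
  refine tendsto_of_tendsto_of_tendsto_of_le_of_le hlower tendsto_const_nhds (fun n ↦ ?_)
    fun n ↦ floor_div_mul_le t (hpos n)
  rw [tsub_le_iff_right, ← add_one_mul]
  exact (div_le_iff₀ (hpos n)).1 (Nat.lt_floor_add_one _).le

lemma eventually_floor_div_lt_floor_div {s : ℝ≥0} (hst : s < t) (hpos : ∀ n, 0 < h n)
    (hh : Tendsto h atTop (𝓝 0)) : ∀ᶠ n in atTop, ⌊s / h n⌋₊ < ⌊t / h n⌋₊ := by
  filter_upwards [hh.eventually_lt_const (tsub_pos_of_lt hst)] with n hn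
  rw [← Nat.add_one_le_iff, ← Nat.floor_add_one zero_le]
  gcongr
  rw [le_div_iff₀ (hpos n), add_mul, one_mul, div_mul_cancel₀ _ (hpos n).ne']
  exact (lt_tsub_iff_left.1 hn).le

lemma tendsto_sum_range_floor_div (hpos : ∀ n, 0 < h n) (hh : Tendsto h atTop (𝓝 0))
    {f : ℕ → ℕ → ℝ} {g : ℝ≥0 → ℝ} {B : ℝ} (hfB : ∀ n, ∀ k < ⌊t / h n⌋₊, |f n k| ≤ B)
    (hfg : ∀ s < t, Tendsto (fun n ↦ f n ⌊s / h n⌋₊) atTop (𝓝 (g s))) :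
    Tendsto (fun n ↦ ∑ k ∈ Finset.range ⌊t / h n⌋₊, h n * f n k) atTop
      (𝓝 (∫ s in (0 : ℝ)..t, g s.toNNReal)) := by
  have hpos' n : (0 : ℝ) < h n := hpos n
  have hstep n (s : ℝ≥0) : ∑ k ∈ Finset.range ⌊t / h n⌋₊,
      (Set.Ico (k * (h n : ℝ)) ((k + 1) * h n)).indicator (fun _ ↦ f n k) (s : ℝ) =
        if ⌊s / h n⌋₊ < ⌊t / h n⌋₊ then f n ⌊s / h n⌋₊ else 0 :=
    sum_indicator_Ico_mul_eq_ite (hpos' n) s.coe_nonneg (f n) ⌊t / h n⌋₊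
  simp_rw [fun n ↦ (integral_sum_indicator_Ico_mul (hpos' n).le (f n) (t := t)
    (by exact_mod_cast floor_div_mul_le t (hpos n))).symm]
  refine intervalIntegral.tendsto_integral_filter_of_dominated_convergence (fun _ ↦ |B|)
    (.of_forall fun n ↦ ?_) (.of_forall fun n ↦ ae_of_all _ fun s hs ↦ ?_)
    intervalIntegrable_const ?_
  · exact (Finset.measurable_fun_sum _ fun k _ ↦
      measurable_const.indicator measurableSet_Ico).aestronglyMeasurable
  · rw [Set.uIoc_of_le t.coe_nonneg] at hs
    lift s to ℝ≥0 using hs.1.le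
    rw [hstep, Real.norm_eq_abs]
    split_ifs with hlt
    · exact (hfB n _ hlt).trans (le_abs_self B)
    · exact abs_zero.trans_le (abs_nonneg B)
  · filter_upwards [Measure.ae_ne volume (t : ℝ)] with s hst hs
    rw [Set.uIoc_of_le t.coe_nonneg] at hs
    lift s to ℝ≥0 using hs.1.le
    have hlt : s < t := lt_of_le_of_ne hs.2 (by exact_mod_cast hst)
    rw [Real.toNNReal_coe]
    refine (hfg s hlt).congr' ?_
    filter_upwards [eventually_floor_div_lt_floor_div hlt hpos hh] with n hn
    rw [hstep, if_pos hn]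

end RiemannSums

section ConvergenceInMeasure

variable {Ω : Type*} {mΩ : MeasurableSpace Ω} {P : Measure Ω}

lemma tendstoInMeasure_add {ι E : Type*} [SeminormedAddCommGroup E] {l : Filter ι}
    {f f' : ι → Ω → E} {g g' : Ω → E} (hf : TendstoInMeasure P f l g)
    (hf' : TendstoInMeasure P f' l g') :
    TendstoInMeasure P (fun i ω ↦ f i ω + f' i ω) l fun ω ↦ g ω + g' ω := by
  rw [tendstoInMeasure_iff_norm] at *
  intro ε hε
  have hsum := (hf (ε / 2) (by positivity)).add (hf' (ε / 2) (by positivity))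
  rw [add_zero] at hsum
  refine tendsto_of_tendsto_of_tendsto_of_le_of_le tendsto_const_nhds hsum (fun _ ↦ zero_le)
    fun i ↦ (measure_mono fun ω (hω : ε ≤ _) ↦ ?_).trans (measure_union_le _ _)
  rw [add_sub_add_comm] at hω
  suffices ε / 2 ≤ ‖f i ω - g ω‖ ∨ ε / 2 ≤ ‖f' i ω - g' ω‖ from this
  by_contra! hsmall
  linarith [norm_add_le (f i ω - g ω) (f' i ω - g' ω)]

lemma tendsto_integral_min_one_abs_sq [IsProbabilityMeasure P] {f : ℕ → Ω → ℝ}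
    (hf_meas : ∀ n, Measurable (f n)) (hf : TendstoInMeasure P f atTop fun _ ↦ 0) :
    Tendsto (fun n ↦ ∫ ω, min 1 |f n ω| ^ 2 ∂P) atTop (𝓝 0) := by
  rw [tendstoInMeasure_iff_measureReal_norm] at hf
  refine tendsto_order.2 ⟨fun a ha ↦ .of_forall fun n ↦
    ha.trans_le (integral_nonneg fun ω ↦ sq_nonneg _), fun ε hε ↦ ?_⟩
  filter_upwards [(hf (ε / 2) (by positivity)).eventually_lt_const (by positivity : 0 < ε / 2)]
    with n hn
  simp only [sub_zero, Real.norm_eq_abs] at hn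
  set A := {ω | ε / 2 ≤ |f n ω|}
  have hA : MeasurableSet A := measurableSet_le measurable_const (hf_meas n).abs
  have hind_int : Integrable (A.indicator fun _ ↦ (1 : ℝ)) P :=
    (integrable_const 1).indicator hA
  have hpointwise ω : min 1 |f n ω| ^ 2 ≤ ε / 2 + A.indicator (fun _ ↦ (1 : ℝ)) ω := by
    have hmin : min 1 |f n ω| ^ 2 ≤ min 1 |f n ω| :=
      pow_le_of_le_one (by positivity) (min_le_left _ _) two_ne_zero
    by_cases hω : ω ∈ A
    · rw [Set.indicator_of_mem hω]
      linarith [min_le_left 1 |f n ω|]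
    · rw [Set.indicator_of_notMem hω]
      have hsmall : |f n ω| < ε / 2 := not_le.1 hω
      linarith [min_le_right 1 |f n ω|]
  calc ∫ ω, min 1 |f n ω| ^ 2 ∂P
      ≤ ∫ ω, (ε / 2 + A.indicator (fun _ ↦ (1 : ℝ)) ω) ∂P :=
        integral_mono_of_nonneg (ae_of_all _ fun ω ↦ sq_nonneg _)
          ((integrable_const _).fun_add hind_int) (ae_of_all _ hpointwise)
    _ = ε / 2 + P.real A := by
        rw [integral_add (integrable_const _) hind_int, integral_const, probReal_univ, one_smul,
          integral_indicator_const _ hA, smul_eq_mul, mul_one]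
    _ < ε := by linarith

end ConvergenceInMeasure

section Approximation

variable {Ω : Type*} {mΩ : MeasurableSpace Ω} {P : Measure Ω} {F : Filtration ℝ≥0 mΩ}
  {W S : ℝ≥0 → Ω → ℝ} {μ σ z : ℝ} {h : ℕ → ℝ≥0}

lemma measurable_of_stronglyAdapted {X : ℝ≥0 → Ω → ℝ} (hX : StronglyAdapted F X) (t : ℝ≥0) :
    Measurable (X t) :=
  (hX t).measurable.mono (F.le t) le_rfl

lemma IsItoIntegral.tendstoInMeasure_sum_range_floor_div [IsFiniteMeasure P] {H : ℝ≥0 → Ω → ℝ}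
    {t : ℝ≥0} {I : Ω → ℝ} (hI : IsItoIntegral P H W t I)
    (hH_meas : ∀ s, Measurable (H s)) (hW_meas : ∀ s, Measurable (W s))
    (hH_cont : ∀ᵐ ω ∂P, Continuous fun s ↦ H s ω) (hW_cont : ∀ᵐ ω ∂P, Continuous fun s ↦ W s ω)
    (hpos : ∀ n, 0 < h n) (hh : Tendsto h atTop (𝓝 0)) :
    TendstoInMeasure P (fun n ω ↦ ∑ k ∈ Finset.range ⌊t / h n⌋₊,
      H (k * h n) ω * (W ((k + 1 : ℕ) * h n) ω - W (k * h n) ω)) atTop I := by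
  set p : ℕ → ℕ → ℝ≥0 := fun n k ↦ min (k * h n) t with hp_def
  set M : ℕ → ℕ := fun n ↦ ⌊t / h n⌋₊ with hM_def
  have hp n k (hk : k ≤ M n) : p n k = k * h n :=
    min_eq_left ((mul_le_mul_left (Nat.cast_le.2 hk) _).trans (floor_div_mul_le t (hpos n)))
  have hp_last n : p n (M n + 1) = t := by
    refine min_eq_right ((div_le_iff₀ (hpos n)).1 ?_)
    push_cast
    exact (Nat.lt_floor_add_one _).le
  have hmesh n k : p n (k + 1) - p n k ≤ h n := by
    rw [tsub_le_iff_left]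
    simp only [hp_def, Nat.cast_add, Nat.cast_one, add_mul, one_mul, ← min_add_add_right]
    gcongr
    exact le_self_add
  have hfull := hI (fun n ↦ M n + 1) p
    (fun n a b hab ↦ min_le_min_right t (by gcongr)) (fun n ↦ by simp [hp_def]) hp_last
    (tendsto_of_tendsto_of_tendsto_of_le_of_le tendsto_const_nhds hh (fun _ ↦ zero_le)
      fun n ↦ Finset.sup_le fun k _ ↦ hmesh n k)
  have hlast_cell : TendstoInMeasure P
      (fun n ω ↦ -(H (M n * h n) ω * (W t ω - W (M n * h n) ω))) atTop fun _ ↦ 0 := by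
    refine tendstoInMeasure_of_tendsto_ae (fun n ↦
      ((hH_meas _).mul ((hW_meas _).sub (hW_meas _))).neg.aestronglyMeasurable) ?_
    filter_upwards [hH_cont, hW_cont] with ω hHω hWω
    have hgrid := tendsto_floor_div_mul t hpos hh
    simpa only [sub_self, mul_zero, neg_zero, Function.comp_def, hM_def] using
      (((hHω.tendsto t).comp hgrid).mul
        ((tendsto_const_nhds (x := W t ω)).sub ((hWω.tendsto t).comp hgrid))).neg
  refine (tendstoInMeasure_add hfull hlast_cell).congr (fun n ↦ ae_of_all _ fun ω ↦ ?_)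
    (ae_of_all _ fun ω ↦ add_zero _)
  simp only [Finset.sum_range_succ, hp_last, hp n (M n) le_rfl, add_neg_cancel_right]
  refine Finset.sum_congr rfl fun k hk ↦ ?_
  rw [hp n k (Finset.mem_range.1 hk).le, hp n (k + 1) (Finset.mem_range.1 hk)]

lemma tendsto_leftRiemannSum {f : ℝ≥0 → ℝ} (hf : Continuous f) (t : ℝ≥0) (hpos : ∀ n, 0 < h n)
    (hh : Tendsto h atTop (𝓝 0)) :
    Tendsto (fun n ↦ ∑ k ∈ Finset.range ⌊t / h n⌋₊, h n * f (k * h n)) atTop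
      (𝓝 (∫ s in (0 : ℝ)..t, f s.toNNReal)) := by
  obtain ⟨B, hB⟩ := isCompact_Icc.exists_bound_of_continuousOn (s := Set.Icc 0 t) hf.continuousOn
  exact tendsto_sum_range_floor_div hpos hh (B := B)
    (fun n k hk ↦ hB _ ⟨zero_le, (mul_le_mul_left (Nat.cast_le.2 hk.le) _).trans
      (floor_div_mul_le t (hpos n))⟩)
    fun s _ ↦ (hf.tendsto s).comp (tendsto_floor_div_mul s hpos hh)

namespace IsGeometricBrownianMotion

variable [IsFiniteMeasure P]

lemma tendstoInMeasure_eulerSum (hS : IsGeometricBrownianMotion P F W S μ σ z) (t : ℝ≥0)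
    (hpos : ∀ n, 0 < h n) (hh : Tendsto h atTop (𝓝 0)) :
    TendstoInMeasure P (fun n ↦ eulerSum z (fun k ↦ S (k * h n)) (gridNoise W μ σ (h n))
      ⌊t / h n⌋₊) atTop (S t) := by
  obtain ⟨I, hI, hSI⟩ := hS.sde t
  have hS_meas := measurable_of_stronglyAdapted hS.adapted
  have hdrift : TendstoInMeasure P (fun n ω ↦ z + ∑ k ∈ Finset.range ⌊t / h n⌋₊,
      h n * (μ * S (k * h n) ω)) atTop
        fun ω ↦ z + ∫ s in (0 : ℝ)..t, μ * S s.toNNReal ω := by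
    refine tendstoInMeasure_of_tendsto_ae (fun n ↦ ((Finset.measurable_fun_sum _ fun k _ ↦
      ((hS_meas _).const_mul μ).const_mul _).const_add z).aestronglyMeasurable) ?_
    filter_upwards [hS.cont] with ω hω
    exact (tendsto_leftRiemannSum (hω.const_mul μ) t hpos hh).const_add z
  have hIto := hI.tendstoInMeasure_sum_range_floor_div (fun s ↦ (hS_meas s).const_mul σ)
    (measurable_of_stronglyAdapted hS.brownian.adapted)
    (hS.cont.mono fun ω hω ↦ hω.const_mul σ) hS.brownian.isBrownian.cont hpos hh
  refine (tendstoInMeasure_add hdrift hIto).congr (fun n ↦ ae_of_all _ fun ω ↦ ?_) ?_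
  · simp only [eulerSum, gridNoise, add_assoc, ← Finset.sum_add_distrib]
    refine congr_arg (z + ·) (Finset.sum_congr rfl fun k _ ↦ ?_)
    ring
  · filter_upwards [hSI, hS.initial] with ω hSω hinit
    rw [hSω, hinit]

lemma tendstoInMeasure_eulerSum_sub (hS : IsGeometricBrownianMotion P F W S μ σ z) (t : ℝ≥0)
    (hpos : ∀ n, 0 < h n) (hh : Tendsto h atTop (𝓝 0)) :
    TendstoInMeasure P (fun n ω ↦
      eulerSum z (fun k ↦ S (k * h n)) (gridNoise W μ σ (h n)) ⌊t / h n⌋₊ ω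
        - S (⌊t / h n⌋₊ * h n) ω) atTop fun _ ↦ 0 := by
  have hS_meas := measurable_of_stronglyAdapted hS.adapted
  have hgrid : TendstoInMeasure P (fun n ω ↦ -S (⌊t / h n⌋₊ * h n) ω) atTop fun ω ↦ -S t ω := by
    refine tendstoInMeasure_of_tendsto_ae (fun n ↦ (hS_meas _).neg.aestronglyMeasurable) ?_
    filter_upwards [hS.cont] with ω hω
    exact ((hω.tendsto t).comp (tendsto_floor_div_mul t hpos hh)).neg
  simpa only [add_neg_cancel, ← sub_eq_add_neg] using
    tendstoInMeasure_add (hS.tendstoInMeasure_eulerSum t hpos hh) hgrid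

end IsGeometricBrownianMotion

end Approximation

section Localization

variable {Ω : Type*} {mΩ : MeasurableSpace Ω} {P : Measure Ω} {𝒢 : Filtration ℕ mΩ}
  {s ξ : ℕ → Ω → ℝ} {N : ℝ} {k : ℕ} {ω : Ω}

/-- The event that `|s|` has not exceeded `N` up to time `k`. -/
def boundedSet (s : ℕ → Ω → ℝ) (N : ℝ) (k : ℕ) : Set Ω :=
  {ω | ∀ j ≤ k, |s j ω| ≤ N}

/-- The event that `|s|` has not exceeded `N` up to time `k` and that the Euler sum with
coefficients `s` is within distance `1` of `s` at time `k`. -/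
def trackedSet (z : ℝ) (s ξ : ℕ → Ω → ℝ) (N : ℝ) (k : ℕ) : Set Ω :=
  boundedSet s N k ∩ {ω | |eulerSum z s ξ k ω - s k ω| < 1}

/-- The Euler sum with coefficients `s`, stopped once `|s|` exceeds `N`. -/
noncomputable def localizedSum (z : ℝ) (s ξ : ℕ → Ω → ℝ) (N : ℝ) : ℕ → Ω → ℝ :=
  eulerSum z (fun k ↦ (boundedSet s N k).indicator (s k)) ξ

/-- The multiplicative scheme whose noise is switched on only on `trackedSet`. -/
noncomputable def localizedProd (z : ℝ) (s ξ : ℕ → Ω → ℝ) (N : ℝ) : ℕ → Ω → ℝ :=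
  eulerProd z (fun k ↦ (trackedSet z s ξ N k).indicator 1) ξ

/-- The Euler sum corrected by the gap between the two localized schemes: it has the same limit as
the Euler sum, and it is equal to the multiplicative scheme as long as `|s| ≤ N`. -/
noncomputable def correctedSum (z : ℝ) (s ξ : ℕ → Ω → ℝ) (N : ℝ) (k : ℕ) (ω : Ω) : ℝ :=
  eulerSum z s ξ k ω + (localizedProd z s ξ N k ω - localizedSum z s ξ N k ω)

lemma localizedSum_of_mem_boundedSet (z : ℝ) (ξ : ℕ → Ω → ℝ) (hω : ω ∈ boundedSet s N k) :
    localizedSum z s ξ N k ω = eulerSum z s ξ k ω :=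
  eulerSum_congr z ξ fun i hi ↦ Set.indicator_of_mem
    (show ω ∈ boundedSet s N i from fun j hj ↦ hω j (hj.trans hi.le)) _

lemma correctedSum_of_mem_boundedSet (z : ℝ) (ξ : ℕ → Ω → ℝ) (hω : ω ∈ boundedSet s N k) :
    correctedSum z s ξ N k ω = localizedProd z s ξ N k ω := by
  rw [correctedSum, localizedSum_of_mem_boundedSet z ξ hω, add_sub_cancel]

lemma measurableSet_boundedSet (hs : Adapted 𝒢 s) (N : ℝ) (k : ℕ) :
    MeasurableSet[𝒢 k] (boundedSet s N k) := by
  have heq : boundedSet s N k = ⋂ j ∈ Set.Iic k, {ω | |s j ω| ≤ N} := by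
    ext ω
    simp [boundedSet]
  rw [heq]
  exact MeasurableSet.biInter (Set.to_countable _) fun j hj ↦ measurableSet_le
    (mδ := 𝒢 k) (continuous_abs.measurable.comp (hs.measurable_le hj)) measurable_const

lemma adapted_indicator_boundedSet (hs : Adapted 𝒢 s) (N : ℝ) :
    Adapted 𝒢 fun k ↦ (boundedSet s N k).indicator (s k) :=
  fun k ↦ (hs k).indicator (measurableSet_boundedSet hs N k)

lemma abs_indicator_boundedSet_le (hN : 0 ≤ N) (k : ℕ) (ω : Ω) :
    |(boundedSet s N k).indicator (s k) ω| ≤ N := by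
  by_cases hω : ω ∈ boundedSet s N k
  · rw [Set.indicator_of_mem hω]
    exact hω k le_rfl
  · rwa [Set.indicator_of_notMem hω, abs_zero]

lemma memLp_indicator_boundedSet [IsFiniteMeasure P] (hs : Adapted 𝒢 s) (hN : 0 ≤ N) (k : ℕ)
    (p : ℝ≥0∞) : MemLp ((boundedSet s N k).indicator (s k)) p P :=
  MemLp.of_bound ((adapted_indicator_boundedSet hs N k).mono (𝒢.le k) le_rfl).aestronglyMeasurable N
    (ae_of_all _ (abs_indicator_boundedSet_le hN k))

lemma abs_indicator_sub_indicator_mul_le (z : ℝ) (s ξ : ℕ → Ω → ℝ) (N y : ℝ) (k : ℕ) (ω : Ω) :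
    |(boundedSet s N k).indicator (s k) ω - (trackedSet z s ξ N k).indicator 1 ω * y| ≤
      |localizedSum z s ξ N k ω - y| + |max 1 N * min 1 (|eulerSum z s ξ k ω - s k ω|)| := by
  have hmax_pos : 0 < max 1 N := zero_lt_one.trans_le (le_max_left 1 N)
  rw [abs_of_nonneg (mul_nonneg hmax_pos.le
    (le_min zero_le_one (abs_nonneg (eulerSum z s ξ k ω - s k ω))))]
  by_cases hbdd : ω ∈ boundedSet s N k
  · rw [Set.indicator_of_mem hbdd, localizedSum_of_mem_boundedSet z ξ hbdd]
    rcases lt_or_ge |eulerSum z s ξ k ω - s k ω| 1 with hclose | hfar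
    · rw [Set.indicator_of_mem (show ω ∈ trackedSet z s ξ N k from ⟨hbdd, hclose⟩), Pi.one_apply,
        one_mul, min_eq_right hclose.le]
      refine (abs_sub_le (s k ω) (eulerSum z s ξ k ω) y).trans ?_
      rw [abs_sub_comm (s k ω), add_comm]
      gcongr
      exact le_mul_of_one_le_left (abs_nonneg _) (le_max_left 1 N)
    · rw [Set.indicator_of_notMem (show ω ∉ trackedSet z s ξ N k from fun h ↦ h.2.not_ge hfar),
        zero_mul, sub_zero, min_eq_left hfar, mul_one]
      exact (hbdd k le_rfl).trans ((le_max_right 1 N).trans (le_add_of_nonneg_left (abs_nonneg _)))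
  · rw [Set.indicator_of_notMem hbdd, Set.indicator_of_notMem fun h ↦ hbdd h.1, zero_mul, sub_zero,
      abs_zero]
    positivity

lemma indicator_one_mem_Icc (A : Set Ω) (ω : Ω) : A.indicator (1 : Ω → ℝ) ω ∈ Set.Icc 0 1 :=
  ⟨Set.indicator_nonneg (fun _ _ ↦ zero_le_one) ω,
    Set.indicator_le_self' (fun _ _ ↦ zero_le_one) ω⟩

lemma abs_indicator_one_le (A : Set Ω) (ω : Ω) : |A.indicator (1 : Ω → ℝ) ω| ≤ 1 :=
  (abs_of_nonneg (indicator_one_mem_Icc A ω).1).trans_le (indicator_one_mem_Icc A ω).2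

namespace IsInnovation

lemma measurableSet_trackedSet (hξ : IsInnovation P 𝒢 ξ) (z : ℝ) (hs : Adapted 𝒢 s) (N : ℝ)
    (k : ℕ) : MeasurableSet[𝒢 k] (trackedSet z s ξ N k) :=
  (measurableSet_boundedSet hs N k).inter <| measurableSet_lt (mδ := 𝒢 k)
    (continuous_abs.measurable.comp ((hξ.adapted_eulerSum z hs k).sub (hs k))) measurable_const

lemma adapted_indicator_trackedSet (hξ : IsInnovation P 𝒢 ξ) (z : ℝ) (hs : Adapted 𝒢 s) (N : ℝ) :
    Adapted 𝒢 fun k ↦ (trackedSet z s ξ N k).indicator (1 : Ω → ℝ) :=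
  fun k ↦ (measurable_const (a := 1)).indicator (hξ.measurableSet_trackedSet z hs N k)

variable [IsFiniteMeasure P]

lemma memLp_two_localizedSum (hξ : IsInnovation P 𝒢 ξ) (z : ℝ) (hs : Adapted 𝒢 s) (hN : 0 ≤ N)
    (k : ℕ) : MemLp (localizedSum z s ξ N k) 2 P :=
  hξ.memLp_two_eulerSum z (adapted_indicator_boundedSet hs N)
    (fun k ↦ memLp_indicator_boundedSet hs hN k 2) k

lemma memLp_two_localizedProd (hξ : IsInnovation P 𝒢 ξ) (z : ℝ) (hs : Adapted 𝒢 s) (N : ℝ)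
    (k : ℕ) : MemLp (localizedProd z s ξ N k) 2 P :=
  hξ.memLp_two_eulerProd z (hξ.adapted_indicator_trackedSet z hs N)
    (fun _ ↦ abs_indicator_one_le _) k

lemma integral_localizedSum_sub_localizedProd_sq_le (hξ : IsInnovation P 𝒢 ξ) (z : ℝ)
    (hs : Adapted 𝒢 s) (hN : 0 ≤ N) {v : ℝ} (hmean : ∀ k, |∫ ω, ξ k ω ∂P| ≤ v)
    (hsq : ∀ k, ∫ ω, ξ k ω ^ 2 ∂P ≤ v) (n : ℕ) :
    ∫ ω, (localizedSum z s ξ N n ω - localizedProd z s ξ N n ω) ^ 2 ∂P ≤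
      (3 * ∑ k ∈ Finset.range n,
        v * ∫ ω, (max 1 N * min 1 |eulerSum z s ξ k ω - s k ω|) ^ 2 ∂P)
          * Real.exp (5 * (n * v)) := by
  have hc := hξ.adapted_indicator_trackedSet z hs N
  have hcY k : Measurable[𝒢 k] fun ω ↦
      (trackedSet z s ξ N k).indicator 1 ω * localizedProd z s ξ N k ω :=
    (hc k).mul (hξ.adapted_eulerProd z hc k)
  have hcY2 k : MemLp (fun ω ↦
      (trackedSet z s ξ N k).indicator 1 ω * localizedProd z s ξ N k ω) 2 P :=
    (hξ.memLp_two_localizedProd z hs N k).of_le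
      ((hcY k).mono (𝒢.le k) le_rfl).aestronglyMeasurable <| ae_of_all _ fun ω ↦ by
        rw [norm_mul]
        exact mul_le_of_le_one_left (norm_nonneg _) (abs_indicator_one_le _ ω)
  have hr2 k : MemLp (fun ω ↦ max 1 N * min 1 |eulerSum z s ξ k ω - s k ω|) 2 P := by
    have hmeas : Measurable fun ω ↦ eulerSum z s ξ k ω - s k ω :=
      ((hξ.adapted_eulerSum z hs k).sub (hs k)).mono (𝒢.le k) le_rfl
    refine (MemLp.of_bound (measurable_const.min hmeas.abs).aestronglyMeasurable 1
      (ae_of_all _ fun ω ↦ ?_)).const_mul _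
    rw [Real.norm_of_nonneg (by positivity)]
    exact min_le_left _ _
  simp only [localizedSum, localizedProd, eulerSum_sub_eulerProd]
  refine hξ.integral_eulerSum_sq_le
    (a := fun k ω ↦ (boundedSet s N k).indicator (s k) ω -
      (trackedSet z s ξ N k).indicator 1 ω * localizedProd z s ξ N k ω)
    (fun k ↦ (adapted_indicator_boundedSet hs N k).sub (hcY k)) hr2
    (fun k ↦ (memLp_indicator_boundedSet hs hN k 2).sub (hcY2 k)) (fun k ω ↦ ?_) hmean hsq n
  simp only [localizedProd, ← eulerSum_sub_eulerProd]
  exact abs_indicator_sub_indicator_mul_le z s ξ N _ k ω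

end IsInnovation

end Localization

section Comparison

variable {Ω : Type*} {mΩ : MeasurableSpace Ω} {P : Measure Ω} {F : Filtration ℝ≥0 mΩ}
  {W S : ℝ≥0 → Ω → ℝ} {μ σ z : ℝ} {h : ℕ → ℝ≥0}

lemma tendstoInMeasure_zero_of_tendsto_integral_sq [IsFiniteMeasure P] {f : ℕ → Ω → ℝ}
    (hf2 : ∀ n, MemLp (f n) 2 P) (hf : Tendsto (fun n ↦ ∫ ω, f n ω ^ 2 ∂P) atTop (𝓝 0)) :
    TendstoInMeasure P f atTop fun _ ↦ 0 := by
  rw [tendstoInMeasure_iff_measureReal_norm]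
  intro ε hε
  have hlim := hf.const_mul (ε ^ 2)⁻¹
  rw [mul_zero] at hlim
  refine squeeze_zero (fun n ↦ measureReal_nonneg) (fun n ↦ ?_) hlim
  rw [le_inv_mul_iff₀ (by positivity)]
  have hmarkov := mul_meas_ge_le_integral_of_nonneg (ae_of_all P fun ω ↦ sq_nonneg (f n ω))
    (hf2 n).integrable_sq (ε ^ 2)
  simpa only [sub_zero, Real.norm_eq_abs, ← sq_abs (f n _), sq_le_sq₀ hε.le (abs_nonneg _)]
    using hmarkov

variable [IsProbabilityMeasure P]

namespace IsGeometricBrownianMotion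

lemma tendsto_sum_integral_min_one_abs_eulerSum_sub_sq
    (hS : IsGeometricBrownianMotion P F W S μ σ z) (t : ℝ≥0) (hpos : ∀ n, 0 < h n)
    (hh : Tendsto h atTop (𝓝 0)) :
    Tendsto (fun n ↦ ∑ k ∈ Finset.range ⌊t / h n⌋₊, h n * ∫ ω, min 1
      |eulerSum z (fun k ↦ S (k * h n)) (gridNoise W μ σ (h n)) k ω - S (k * h n) ω| ^ 2 ∂P)
      atTop (𝓝 0) := by
  have hmeas n k : Measurable fun ω ↦
      eulerSum z (fun k ↦ S (k * h n)) (gridNoise W μ σ (h n)) k ω - S (k * h n) ω :=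
    (((hS.brownian.isInnovation_gridNoise μ σ (h n)).adapted_eulerSum z
      (adapted_gridFiltration hS.adapted (h n)) k).mono ((gridFiltration F (h n)).le k) le_rfl).sub
      (measurable_of_stronglyAdapted hS.adapted _)
  have hbound (f : Ω → ℝ) : |∫ ω, min 1 |f ω| ^ 2 ∂P| ≤ 1 := by
    have hle := norm_integral_le_of_norm_le_const (ae_of_all P fun ω ↦
      (Real.norm_of_nonneg (sq_nonneg (min 1 |f ω|))).trans_le
        (pow_le_one₀ (by positivity) (min_le_left _ _)))
    rwa [probReal_univ, mul_one] at hle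
  have hlim (s : ℝ≥0) := tendsto_integral_min_one_abs_sq (fun n ↦ hmeas n ⌊s / h n⌋₊)
    (hS.tendstoInMeasure_eulerSum_sub s hpos hh)
  rw [← intervalIntegral.integral_zero (a := (0 : ℝ)) (b := t)]
  exact tendsto_sum_range_floor_div (t := t) (g := fun _ ↦ 0) hpos hh (fun n k _ ↦ hbound _)
    fun s _ ↦ hlim s

lemma tendsto_integral_localizedSum_sub_localizedProd_sq
    (hS : IsGeometricBrownianMotion P F W S μ σ z) (t : ℝ≥0) {N : ℝ} (hN : 0 ≤ N)
    (hpos : ∀ n, 0 < h n) (hh : Tendsto h atTop (𝓝 0)) (hh1 : ∀ n, h n ≤ 1) :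
    Tendsto (fun n ↦ ∫ ω,
      (localizedSum z (fun k ↦ S (k * h n)) (gridNoise W μ σ (h n)) N ⌊t / h n⌋₊ ω -
        localizedProd z (fun k ↦ S (k * h n)) (gridNoise W μ σ (h n)) N ⌊t / h n⌋₊ ω) ^ 2 ∂P)
      atTop (𝓝 0) := by
  set L : ℝ := |μ| + (μ ^ 2 + σ ^ 2)
  have hL : 0 ≤ L := by positivity
  have hlim := ((hS.tendsto_sum_integral_min_one_abs_eulerSum_sub_sq t hpos hh).const_mul
    (3 * (L * max 1 N ^ 2))).mul_const (Real.exp (5 * (t * L)))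
  rw [mul_zero, zero_mul] at hlim
  refine squeeze_zero (fun n ↦ integral_nonneg fun ω ↦ sq_nonneg _) (fun n ↦ ?_) hlim
  have hmean k : |∫ ω, gridNoise W μ σ (h n) k ω ∂P| ≤ L * h n := by
    rw [hS.brownian.integral_gridNoise, abs_mul, NNReal.abs_eq]
    gcongr
    exact le_add_of_nonneg_right (by positivity)
  have hsq k : ∫ ω, gridNoise W μ σ (h n) k ω ^ 2 ∂P ≤ L * h n :=
    (hS.brownian.integral_gridNoise_sq_le μ σ (hh1 n) k).trans <| by
      gcongr
      exact le_add_of_nonneg_left (abs_nonneg μ)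
  have hgrid : (⌊t / h n⌋₊ * h n : ℝ) ≤ t := by exact_mod_cast floor_div_mul_le t (hpos n)
  refine ((hS.brownian.isInnovation_gridNoise μ σ
    (h n)).integral_localizedSum_sub_localizedProd_sq_le z
      (adapted_gridFiltration hS.adapted (h n)) hN hmean hsq _).trans ?_
  simp only [mul_pow, integral_const_mul, Finset.mul_sum]
  gcongr ?_ * Real.exp (5 * ?_)
  · exact (Finset.sum_congr rfl fun k _ ↦ by ring).le
  · linarith [mul_le_mul_of_nonneg_right hgrid hL]

lemma tendstoInMeasure_correctedSum (hS : IsGeometricBrownianMotion P F W S μ σ z) (t : ℝ≥0)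
    {N : ℝ} (hN : 0 ≤ N) (hpos : ∀ n, 0 < h n) (hh : Tendsto h atTop (𝓝 0)) (hh1 : ∀ n, h n ≤ 1) :
    TendstoInMeasure P (fun n ↦ correctedSum z (fun k ↦ S (k * h n)) (gridNoise W μ σ (h n)) N
      ⌊t / h n⌋₊) atTop (S t) := by
  have hdiff := tendstoInMeasure_zero_of_tendsto_integral_sq (fun n ↦
    ((hS.brownian.isInnovation_gridNoise μ σ (h n)).memLp_two_localizedProd z
      (adapted_gridFiltration hS.adapted (h n)) N ⌊t / h n⌋₊).sub
    ((hS.brownian.isInnovation_gridNoise μ σ (h n)).memLp_two_localizedSum z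
      (adapted_gridFiltration hS.adapted (h n)) hN ⌊t / h n⌋₊))
    ((hS.tendsto_integral_localizedSum_sub_localizedProd_sq t hN hpos hh hh1).congr fun n ↦
      integral_congr_ae (ae_of_all _ fun ω ↦ sub_sq_comm _ _))
  have hsum := tendstoInMeasure_add (hS.tendstoInMeasure_eulerSum t hpos hh) hdiff
  simp only [add_zero] at hsum
  exact hsum

end IsGeometricBrownianMotion

end Comparison

section MaximalInequality

variable {Ω : Type*} {mΩ : MeasurableSpace Ω} {P : Measure Ω} {F : Filtration ℝ≥0 mΩ}
  {W S : ℝ≥0 → Ω → ℝ} {μ σ z : ℝ}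

lemma IsBrownianMotionWrt.exists_measureReal_exists_le_abs_eulerProd_le [IsProbabilityMeasure P]
    (hW : IsBrownianMotionWrt P F W) (μ σ z : ℝ) :
    ∃ C : ℝ, ∀ h : ℝ≥0, 0 < h → h ≤ 1 → ∀ c : ℕ → Ω → ℝ, Adapted (gridFiltration F h) c →
      (∀ k ω, c k ω ∈ Set.Icc 0 1) → ∀ β : ℝ, 0 < β → ∀ T : ℝ≥0,
        P.real {ω | ∃ k ≤ ⌊T / h⌋₊, β ≤ |eulerProd z c (gridNoise W μ σ h) k ω|} ≤
          |z| * Real.exp (T * (max μ 0 + C * h)) / β := by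
  obtain ⟨C, hC, hfourth⟩ := hW.exists_integral_gridNoise_pow_four_le μ σ
  refine ⟨2 * C, fun h hh hh1 c hc hc01 β hβ T ↦ ?_⟩
  refine ((hW.isInnovation_gridNoise μ σ h).measureReal_exists_le_abs_eulerProd_le z hc hc01
    (b := max μ 0 * h) (by positivity) (by positivity) (fun k ↦ ?_) (hfourth h hh1) hβ _).trans ?_
  · rw [hW.integral_gridNoise]
    gcongr
    exact le_max_left μ 0
  · have hgrid : (⌊T / h⌋₊ * h : ℝ) ≤ T := by exact_mod_cast floor_div_mul_le T hh
    gcongr |z| * Real.exp ?_ / β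
    calc ⌊T / h⌋₊ * (max μ 0 * h + 2 * (C * h * h))
        = (⌊T / h⌋₊ * h) * (max μ 0 + 2 * C * h) := by ring
      _ ≤ T * (max μ 0 + 2 * C * h) := by gcongr

lemma measureReal_bounded_and_exists_mem_finset_le_add [IsFiniteMeasure P] (z : ℝ)
    (S : ℝ≥0 → Ω → ℝ) (ξ : ℕ → Ω → ℝ) (N β γ : ℝ) {h T : ℝ≥0} (hh : 0 < h) {s : Finset ℝ≥0}
    (hsT : ∀ t ∈ s, t ≤ T) :
    P.real {ω | (∀ t ≤ T, |S t ω| ≤ N) ∧ ∃ t ∈ s, γ ≤ |S t ω|} ≤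
      P.real {ω | ∃ k ≤ ⌊T / h⌋₊, β ≤ |localizedProd z (fun k ↦ S (k * h)) ξ N k ω|} +
        ∑ t ∈ s, P.real {ω | γ - β ≤
          |correctedSum z (fun k ↦ S (k * h)) ξ N ⌊t / h⌋₊ ω - S t ω|} := by
  refine (measureReal_mono ?_).trans <| (measureReal_union_le _ _).trans <|
    add_le_add_right (measureReal_biUnion_finset_le _ _) _
  rintro ω ⟨hbdd, t, ht, hγ⟩
  have hmem : ω ∈ boundedSet (fun k ↦ S (k * h)) N ⌊t / h⌋₊ := fun j hj ↦ hbdd _ <|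
    ((mul_le_mul_left (Nat.cast_le.2 hj) h).trans (floor_div_mul_le t hh)).trans (hsT t ht)
  by_cases hY : β ≤ |localizedProd z (fun k ↦ S (k * h)) ξ N ⌊t / h⌋₊ ω|
  · exact Or.inl ⟨_, by gcongr; exact hsT t ht, hY⟩
  · refine Or.inr (Set.mem_biUnion ht ?_)
    suffices γ - β ≤ |correctedSum z (fun k ↦ S (k * h)) ξ N ⌊t / h⌋₊ ω - S t ω| from this
    rw [correctedSum_of_mem_boundedSet z ξ hmem, abs_sub_comm]
    exact (sub_le_sub hγ (not_le.1 hY).le).trans (abs_sub_abs_le_abs_sub _ _)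

namespace IsGeometricBrownianMotion

variable [IsProbabilityMeasure P]

lemma measureReal_bounded_and_exists_mem_finset_le
    (hS : IsGeometricBrownianMotion P F W S μ σ z) {T : ℝ≥0} {s : Finset ℝ≥0}
    (hsT : ∀ t ∈ s, t ≤ T) {N : ℝ} (hN : 0 ≤ N) {β γ : ℝ} (hβ : 0 < β) (hβγ : β < γ) :
    P.real {ω | (∀ t ≤ T, |S t ω| ≤ N) ∧ ∃ t ∈ s, γ ≤ |S t ω|} ≤
      |z| * Real.exp (T * max μ 0) / β := by
  obtain ⟨C, hC⟩ := hS.brownian.exists_measureReal_exists_le_abs_eulerProd_le μ σ z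
  obtain ⟨h, -, hh01, hh⟩ := exists_seq_strictAnti_tendsto' (zero_lt_one (α := ℝ≥0))
  have hpos n : 0 < h n := (hh01 n).1
  have hh1 n : h n ≤ 1 := (hh01 n).2.le
  have hmain : Tendsto (fun n ↦ |z| * Real.exp (T * (max μ 0 + C * h n)) / β) atTop
      (𝓝 (|z| * Real.exp (T * max μ 0) / β)) := by
    have hcont : Continuous fun x : ℝ≥0 ↦ |z| * Real.exp (T * (max μ 0 + C * x)) / β := by fun_prop
    simpa only [Function.comp_def, NNReal.coe_zero, mul_zero, add_zero] using
      (hcont.tendsto 0).comp hh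
  have herror := tendsto_finsetSum s fun t _ ↦ tendstoInMeasure_iff_measureReal_norm.1
    (hS.tendstoInMeasure_correctedSum t hN hpos hh hh1) _ (sub_pos.2 hβγ)
  rw [Finset.sum_const_zero] at herror
  refine ge_of_tendsto' (by simpa only [add_zero] using hmain.add herror) fun n ↦ ?_
  refine (measureReal_bounded_and_exists_mem_finset_le_add z S (gridNoise W μ σ (h n)) N β γ
    (hpos n) hsT).trans (add_le_add_left (hC (h n) (hpos n) (hh1 n) _ ?_ ?_ β hβ T) _)
  · exact (hS.brownian.isInnovation_gridNoise μ σ (h n)).adapted_indicator_trackedSet z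
      (adapted_gridFiltration hS.adapted (h n)) N
  · exact fun k ↦ indicator_one_mem_Icc _

lemma measure_exists_mem_finset_le (hS : IsGeometricBrownianMotion P F W S μ σ z) {T : ℝ≥0}
    {s : Finset ℝ≥0} (hsT : ∀ t ∈ s, t ≤ T) {β γ : ℝ} (hβ : 0 < β) (hβγ : β < γ) :
    P {ω | ∃ t ∈ s, γ ≤ |S t ω|} ≤ ENNReal.ofReal (|z| * Real.exp (T * max μ 0) / β) := by
  set A : ℕ → Set Ω := fun N ↦ {ω | (∀ t ≤ T, |S t ω| ≤ N) ∧ ∃ t ∈ s, γ ≤ |S t ω|}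
  have hA_mono : Monotone A := fun N N' hN ω hω ↦
    ⟨fun t ht ↦ (hω.1 t ht).trans (Nat.cast_le.2 hN), hω.2⟩
  have hsub : {ω | ∃ t ∈ s, γ ≤ |S t ω|} ≤ᵐ[P] ⋃ N, A N := by
    filter_upwards [hS.cont] with ω hcont hω
    obtain ⟨C, hC⟩ := (isCompact_Icc (a := 0) (b := T)).exists_bound_of_continuousOn
      hcont.continuousOn
    obtain ⟨N, hN⟩ := exists_nat_ge C
    exact Set.mem_iUnion.2 ⟨N, fun t ht ↦ (hC t ⟨zero_le, ht⟩).trans hN, hω⟩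
  calc P {ω | ∃ t ∈ s, γ ≤ |S t ω|} ≤ P (⋃ N, A N) := measure_mono_ae hsub
    _ = ⨆ N, P (A N) := hA_mono.measure_iUnion
    _ ≤ ENNReal.ofReal (|z| * Real.exp (T * max μ 0) / β) := iSup_le fun N ↦ by
      rw [← ofReal_measureReal]
      exact ENNReal.ofReal_le_ofReal
        (hS.measureReal_bounded_and_exists_mem_finset_le hsT N.cast_nonneg hβ hβγ)

lemma measure_exists_lt_abs_le (hS : IsGeometricBrownianMotion P F W S μ σ z) (hμ : μ ≤ 0)
    {β γ : ℝ} (hβ : 0 < β) (hβγ : β < γ) :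
    P {ω | ∃ t, γ < |S t ω|} ≤ ENNReal.ofReal (|z| / β) := by
  let d : ℕ → ℝ≥0 := TopologicalSpace.denseSeq ℝ≥0
  set A : ℕ → Set Ω := fun n ↦ {ω | ∃ t ∈ (Finset.range n).image d, γ ≤ |S t ω|}
  have hA_mono : Monotone A := by
    rintro m n hmn ω ⟨t, ht, hγ⟩
    exact ⟨t, Finset.image_subset_image (Finset.range_mono hmn) ht, hγ⟩
  have hsub : {ω | ∃ t, γ < |S t ω|} ≤ᵐ[P] ⋃ n, A n := by
    filter_upwards [hS.cont] with ω hcont ⟨t, ht⟩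
    obtain ⟨k, hk⟩ := (TopologicalSpace.denseRange_denseSeq ℝ≥0).exists_mem_open
      (isOpen_lt continuous_const hcont.abs) ⟨t, ht⟩
    exact Set.mem_iUnion.2 ⟨k + 1, d k,
      Finset.mem_image_of_mem d (Finset.self_mem_range_succ k), hk.le⟩
  calc P {ω | ∃ t, γ < |S t ω|} ≤ P (⋃ n, A n) := measure_mono_ae hsub
    _ = ⨆ n, P (A n) := hA_mono.measure_iUnion
    _ ≤ ENNReal.ofReal (|z| / β) := iSup_le fun n ↦ by
      simpa only [max_eq_right hμ, mul_zero, Real.exp_zero, mul_one] using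
        hS.measure_exists_mem_finset_le (fun t ht ↦ Finset.le_sup (f := id) ht) hβ hβγ

end IsGeometricBrownianMotion

end MaximalInequality

theorem mainTheorem10_general {Ω : Type*} {mΩ : MeasurableSpace Ω} (P : Measure Ω)
    [IsProbabilityMeasure P] (F : Filtration ℝ≥0 mΩ) (W S : ℝ≥0 → Ω → ℝ) (μ σ z : ℝ) (hμ : μ ≤ 0)
    (hS : IsGeometricBrownianMotion P F W S μ σ z) (α : ℝ) (hα : 0 < α) :
    P {ω | (α : EReal) ≤ ⨆ t, ((|S t ω| : ℝ) : EReal)} ≤ ENNReal.ofReal (|z| / α) := by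
  have hlim : Tendsto (fun β ↦ ENNReal.ofReal (|z| / β)) (𝓝[<] α) (𝓝 (ENNReal.ofReal (|z| / α))) :=
    (ENNReal.tendsto_ofReal (tendsto_const_nhds.div tendsto_id hα.ne')).mono_left nhdsWithin_le_nhds
  refine ge_of_tendsto hlim ?_
  filter_upwards [Ioo_mem_nhdsLT hα] with β ⟨hβ, hβα⟩
  obtain ⟨γ, hβγ, hγα⟩ := exists_between hβα
  refine (measure_mono fun ω (hω : (α : EReal) ≤ _) ↦ ?_).trans
    (hS.measure_exists_lt_abs_le hμ hβ hβγ)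
  obtain ⟨t, ht⟩ := lt_iSup_iff.1 ((EReal.coe_lt_coe_iff.2 hγα).trans_le hω)
  exact ⟨t, EReal.coe_lt_coe_iff.1 ht⟩

theorem mainTheorem10 {Ω : Type*} {mΩ : MeasurableSpace Ω} (P : Measure Ω) [IsProbabilityMeasure P]
    (F : Filtration ℝ≥0 mΩ) (W S : ℝ≥0 → Ω → ℝ) (μ σ z : ℝ)
    (hμ : μ < 0) (hσ : 0 < σ) (hz : 0 < z)
    (hS : IsGeometricBrownianMotion P F W S μ σ z) (α : ℝ) (hα : z < α) :
    P {ω | (α : EReal) ≤ ⨆ t : {t : ℝ≥0 // 0 < t}, (S t ω : EReal)} ≤ ENNReal.ofReal (z / α) := by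
  have hmax := mainTheorem10_general P F W S μ σ z hμ.le hS α (hz.trans hα)
  rw [abs_of_pos hz] at hmax
  refine (measure_mono fun ω hω ↦ ?_).trans hmax
  exact le_trans (show (α : EReal) ≤ _ from hω) (iSup_le fun t ↦
    le_iSup_of_le (f := fun t ↦ ((|S t ω| : ℝ) : EReal)) t.1
      (EReal.coe_le_coe_iff.2 (le_abs_self _)))
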